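/- Let $N\subset\mathbb{R}^q$ be a smooth embedded submanifold (without boundary) with the induced Riemannian metric $\langle\cdot,\cdot\rangle$; by Nash's theorem this is an arbitrary Riemannian manifold. For $y\in N$ let $P_y$ be the orthogonal projection of $\mathbb{R}^q$ onto $T_yN$, and let $R^N(X,Y)Z=[\nabla_X,\nabla_Y]Z-\nabla_{[X,Y]}Z$ be the curvature tensor of $N$. For $m\ge 1$ let $\phi\in W^{2,2}_{loc}(\mathbb{R}^m,N)\cap L^\infty_{loc}(\mathbb{R}^m,N)$, that is, $\phi:\mathbb{R}^m\to\mathbb{R}^q$ is of class $W^{2,2}_{loc}\cap L^\infty_{loc}$ and $\phi(x)\in N$ for almost every $x$. Put $d\phi(e_i)=\partial_i\phi$, $\bar\nabla_jV=P_\phi(\partial_jV)$ for sections $V$ of $\phi^*TN$ (weak derivatives), $\bar\Delta V=\sum_j\bar\nabla_j\bar\nabla_jV$, and $\tau(\phi)=\sum_i\bar\nabla_id\phi(e_i)$. Let $\delta_1,\delta_2\in\mathbb{R}\setminus\{0\}$ and suppose: (a) $\phi$ is a weak solution of $$\delta_2\bar\Delta\tau(\phi)=\delta_2\sum_jR^N(d\phi(e_j),\tau(\phi))d\phi(e_j)+\delta_1\tau(\phi),$$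 i.e. the curvature term is in $L^1_{loc}$ and $\int\delta_2\langle\tau(\phi),\bar\Delta V\rangle=\int\big(\delta_2\langle\sum_jR^N(d\phi(e_j),\tau(\phi))d\phi(e_j),V\rangle+\delta_1\langle\tau(\phi),V\rangle\big)$ for all bounded, compactly supported sections $V$ of $\phi^*TN$ with weak derivatives $\partial_jV\in L^4$ and $\partial_j\bar\nabla_jV\in L^2$. (b) $\phi$ is stationary: the stress-energy tensor $$S_{ij}=\delta_1\big(2\langle d\phi(e_i),d\phi(e_j)\rangle-\delta_{ij}|d\phi|^2\big)+\delta_2\Big(-|\tau(\phi)|^2+2\sum_l\partial_l\langle d\phi(e_l),\tau(\phi)\rangle\Big)\delta_{ij}-2\delta_2\big(\langle d\phi(e_i),\bar\nabla_j\tau(\phi)\rangle+\langle d\phi(e_j),\bar\nabla_i\tau(\phi)\rangle\big),$$ understood as a distribution (the derivatives of $\tau(\phi)$ and of $\langle d\phi(e_l),\tau(\phi)\rangle$ being moved to the other factors by integration by parts), satisfies $\int_{\mathbb{R}^m}\sum_{i,j}k^{ij}S_{ij}\,dV=0$ for every $k_{ij}=\partial_iY_j+\partial_jY_i$ with $Y\in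 C_c^\infty(\mathbb{R}^m,\mathbb{R}^m)$ (in particular, this holds if the integral vanishes for every smooth compactly supported symmetric $2$-tensor $k$). (c) $\displaystyle\int_{\mathbb{R}^m}\big(|d\phi|^2+|\bar\nabla d\phi|^2\big)\,dV<\infty.$ Then: 1. if $m=1$ and $\delta_1,\delta_2>0$, then $\phi$ is trivial, i.e. almost everywhere equal to a constant $c\in N$; 2. if $m=2$ and $\delta_2>0$, then $\phi$ is harmonic, i.e. $\tau(\phi)=0$ almost everywhere; 3. if $m=3$ and $\delta_1<0<\delta_2$, then $\phi$ is trivial; 4. if $m=4$ and $\delta_1<0$, then $\phi$ is trivial; 5. if $m\ge5$ and $\delta_1,\delta_2<0$, then $\phi$ is trivial. -/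

import Mathlib

open MeasureTheory Filter Topology
open scoped ContDiff

namespace SesquiHarmonic

noncomputable section

/-- Euclidean space `ℝ^d` with its Euclidean inner product. -/
abbrev Euc (d : ℕ) : Type := EuclideanSpace ℝ (Fin d)

/-- The `i`-th vector of the standard orthonormal basis of `ℝ^m`. -/
def stdVec {m : ℕ} (i : Fin m) : Euc m := EuclideanSpace.single i (1 : ℝ)

/-- The classical partial derivative `∂_i f` (used for smooth functions only). -/
def pderiv {m : ℕ} (i : Fin m) (f : Euc m → ℝ) (x : Euc m) : ℝ :=
  fderiv ℝ f x (stdVec i)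

/-! ### The target manifold

The target is a smooth embedded submanifold `N` of some `ℝ^q`, with the induced Riemannian metric. -/

section Target

variable {q : ℕ}

/-- `N` is a smooth embedded submanifold (without boundary) of `ℝ^q` of dimension `n`: near each of
its points it is mapped by a diffeomorphism between open sets of `ℝ^q` onto an open piece of an
`n`-dimensional linear subspace. It need not be closed, compact or connected. -/
def IsSmoothSubmanifold (n : ℕ) (N : Set (Euc q)) : Prop :=
  ∀ y ∈ N, ∃ (e : OpenPartialHomeomorph (Euc q) (Euc q)) (F : Submodule ℝ (Euc q)),
    y ∈ e.source ∧ ContDiffOn ℝ ∞ e e.source ∧ ContDiffOn ℝ ∞ e.symm e.target ∧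
    Module.finrank ℝ F = n ∧ ∀ z ∈ e.source, (z ∈ N ↔ e z ∈ F)

/-- The tangent space `T_y N`, spanned by the velocities at `y` of the curves in `N` through `y`
(for a submanifold these velocities already form a linear subspace). -/
def tangentSpace (N : Set (Euc q)) (y : Euc q) : Submodule ℝ (Euc q) :=
  Submodule.span ℝ {v | ∃ γ : ℝ → Euc q, γ 0 = y ∧ (∀ᶠ t in 𝓝 (0 : ℝ), γ t ∈ N) ∧
    HasDerivAt γ v 0}

/-- The orthogonal projection `P_y` of `ℝ^q` onto `T_y N`. -/
def tangentProj (N : Set (Euc q)) (y : Euc q) : Euc q →L[ℝ] Euc q :=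
  (tangentSpace N y).starProjection

/-- The Levi-Civita connection of the induced metric, `(∇_X Y)(y) = P_y (D_{X(y)} Y)`. -/
def leviCivita (N : Set (Euc q)) (X Y : Euc q → Euc q) (y : Euc q) : Euc q :=
  tangentProj N y (fderivWithin ℝ Y N y (X y))

/-- The Lie bracket `[X, Y]` of tangential vector fields on `N`. -/
def lieBracketOn (N : Set (Euc q)) (X Y : Euc q → Euc q) (y : Euc q) : Euc q :=
  fderivWithin ℝ Y N y (X y) - fderivWithin ℝ X N y (Y y)

/-- The extension of a vector `v ∈ T_y N` to the tangential vector field `p ↦ P_p v` on `N`. -/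
def extendTangent (N : Set (Euc q)) (v : Euc q) (p : Euc q) : Euc q := tangentProj N p v

/-- The Riemann curvature tensor `R^N(u, v) w = ∇_X ∇_Y Z - ∇_Y ∇_X Z - ∇_{[X, Y]} Z` at `y`, where
`X, Y, Z` are tangential fields on `N` that extend `u, v, w ∈ T_y N`. -/
def curvature (N : Set (Euc q)) (y u v w : Euc q) : Euc q :=
  let X := extendTangent N u
  let Y := extendTangent N v
  let Z := extendTangent N w
  leviCivita N X (leviCivita N Y Z) y - leviCivita N Y (leviCivita N X Z) y -
    leviCivita N (lieBracketOn N X Y) Z y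

end Target

/-! ### Weak derivatives and Sobolev maps -/

section Sobolev

variable {m q : ℕ}

/-- `v` is the weak partial derivative `∂_i u` of `u` on `ℝ^m`. -/
def HasWeakPartial (i : Fin m) (u v : Euc m → Euc q) : Prop :=
  LocallyIntegrable u volume ∧ LocallyIntegrable v volume ∧
    ∀ η : Euc m → ℝ, ContDiff ℝ ∞ η → HasCompactSupport η →
      ∫ x, pderiv i η x • u x = -∫ x, η x • v x

open Classical in
/-- The weak partial derivative `∂_i u` (unique almost everywhere; `0` if there is none). -/
def weakPartial (i : Fin m) (u : Euc m → Euc q) : Euc m → Euc q :=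
  if h : ∃ v, HasWeakPartial i u v then h.choose else 0

/-- `u ∈ L²_loc(ℝ^m, ℝ^q)`. -/
def MemL2loc (u : Euc m → Euc q) : Prop :=
  ∀ K : Set (Euc m), IsCompact K → MemLp u 2 (volume.restrict K)

/-- `φ ∈ W^{2,2}_loc(ℝ^m, N)`: `φ` takes values in `N` almost everywhere, and `φ` has weak partial
derivatives of first and second order; all of these and `φ` itself belong to `L²_loc`. -/
structure MemW22loc (N : Set (Euc q)) (φ : Euc m → Euc q) : Prop where
  mem : ∀ᵐ x, φ x ∈ N
  memL2 : MemL2loc φ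
  hasWeakPartial : ∀ i, HasWeakPartial i φ (weakPartial i φ)
  memL2_first : ∀ i, MemL2loc (weakPartial i φ)
  hasWeakPartial_second : ∀ i j,
    HasWeakPartial j (weakPartial i φ) (weakPartial j (weakPartial i φ))
  memL2_second : ∀ i j, MemL2loc (weakPartial j (weakPartial i φ))

/-- `φ ∈ L^∞_loc` (measurability is part of `MemW22loc`). -/
def MemLinftyLoc (φ : Euc m → Euc q) : Prop :=
  ∀ K : Set (Euc m), IsCompact K → ∃ C : ℝ, ∀ᵐ x ∂(volume.restrict K), ‖φ x‖ ≤ C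

end Sobolev

/-! ### Geometry of a map `φ : ℝ^m → N ⊆ ℝ^q` -/

section Maps

variable {m q : ℕ} (N : Set (Euc q)) (φ : Euc m → Euc q)

/-- The pull-back connection on `φ^* TN`: `∇̄_j V = P_φ (∂_j V)` for a section `V` along `φ`. -/
def covDeriv (j : Fin m) (V : Euc m → Euc q) (x : Euc m) : Euc q :=
  tangentProj N (φ x) (weakPartial j V x)

/-- The component `(∇̄_j dφ)(e_i)` of `∇̄ dφ`; here `dφ(e_i) = ∂_i φ`. -/
def secondDeriv (j i : Fin m) : Euc m → Euc q := covDeriv N φ j (weakPartial i φ)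

/-- The tension field `τ(φ) = Tr ∇̄ dφ`. -/
def tension (x : Euc m) : Euc q := ∑ i, secondDeriv N φ i i x

/-- `|dφ|²`. -/
def normSqDeriv (x : Euc m) : ℝ := ∑ i, ‖weakPartial i φ x‖ ^ 2

/-- `|∇̄ dφ|²`. -/
def normSqSecondDeriv (x : Euc m) : ℝ := ∑ i, ∑ j, ‖secondDeriv N φ j i x‖ ^ 2

/-- The connection Laplacian `Δ̄ V = Tr ∇̄ ∇̄ V` on `φ^* TN`. -/
def roughLaplacian (V : Euc m → Euc q) (x : Euc m) : Euc q :=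
  ∑ j, covDeriv N φ j (covDeriv N φ j V) x

/-- The curvature term `∑_j R^N(dφ(e_j), τ(φ)) dφ(e_j)`. -/
def curvatureTerm (x : Euc m) : Euc q :=
  ∑ j, curvature N (φ x) (weakPartial j φ x) (tension N φ x) (weakPartial j φ x)

/-- Admissible test sections of `φ^* TN`: bounded, with compact support, with `∂_j V ∈ L⁴` and
`∂_j ∇̄_j V ∈ L²`. For bounded `φ` of class `W^{2,2}` all the `P_φ W` with `W` smooth and compactly
supported are of this kind. -/
structure IsTestSection (V : Euc m → Euc q) : Prop where
  tangent : ∀ᵐ x, V x ∈ tangentSpace N (φ x)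
  compactSupport : HasCompactSupport V
  bounded : ∃ C : ℝ, ∀ᵐ x, ‖V x‖ ≤ C
  hasWeakPartial : ∀ j, HasWeakPartial j V (weakPartial j V)
  memLp_first : ∀ j, MemLp (weakPartial j V) 4 volume
  hasWeakPartial_second : ∀ j,
    HasWeakPartial j (covDeriv N φ j V) (weakPartial j (covDeriv N φ j V))
  memLp_second : ∀ j, MemLp (weakPartial j (covDeriv N φ j V)) 2 volume

/-- `φ` solves `δ₂ Δ̄ τ(φ) = δ₂ R^N(dφ(e_j), τ(φ)) dφ(e_j) + δ₁ τ(φ)` in the sense of distributions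
(both derivatives in `Δ̄` are put on the test section). -/
structure IsWeakSolution (δ₁ δ₂ : ℝ) : Prop where
  locallyIntegrable : LocallyIntegrable (curvatureTerm N φ) volume
  equation : ∀ V : Euc m → Euc q, IsTestSection N φ V →
    ∫ x, δ₂ * inner ℝ (tension N φ x) (roughLaplacian N φ V x) =
      ∫ x, (δ₂ * inner ℝ (curvatureTerm N φ x) (V x) + δ₁ * inner ℝ (tension N φ x) (V x))

/-- The pairing `∫ k^{ij} S_{ij} dV` of a smooth compactly supported tensor `k` with the
stress-energy tensor
`S_ij = δ₁ (2 ⟨dφ(e_i), dφ(e_j)⟩ - g_ij |dφ|²) + δ₂ (-|τ|² + 2 ∇_l ⟨dφ(e_l), τ⟩) g_ij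
  - 2 δ₂ (⟨dφ(e_i), ∇̄_j τ⟩ + ⟨dφ(e_j), ∇̄_i τ⟩)`.
For `φ` in `W^{2,2}_loc` the tensor `S` is a distribution: the outer derivative of `⟨dφ(e_l), τ⟩`
and the derivative of `τ` are put on the other factors,
`∫ f ∇_l ⟨dφ(e_l), τ⟩ = -∫ ∂_l f ⟨dφ(e_l), τ⟩` and
`∫ f ⟨dφ(e_i), ∇̄_j τ⟩ = -∫ (∂_j f ⟨dφ(e_i), τ⟩ + f ⟨∇̄_j dφ(e_i), τ⟩)`. -/
def stressPairing (δ₁ δ₂ : ℝ) (k : Fin m → Fin m → Euc m → ℝ) : ℝ :=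
  ∫ x,
    (δ₁ * (∑ i, ∑ j, k i j x * (2 * inner ℝ (weakPartial i φ x) (weakPartial j φ x))
        - (∑ i, k i i x) * normSqDeriv φ x)
      - δ₂ * ((∑ i, k i i x) * ‖tension N φ x‖ ^ 2)
      - 2 * δ₂ * ∑ l, (∑ i, pderiv l (k i i) x) * inner ℝ (weakPartial l φ x) (tension N φ x)
      + 2 * δ₂ * ∑ i, ∑ j,
          (pderiv j (k i j) x * inner ℝ (weakPartial i φ x) (tension N φ x)
            + k i j x * inner ℝ (secondDeriv N φ j i x) (tension N φ x)
            + pderiv i (k i j) x * inner ℝ (weakPartial j φ x) (tension N φ x)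
            + k i j x * inner ℝ (secondDeriv N φ i j x) (tension N φ x)))

/-- The Lie derivative `(L_Y g)_ij = ∂_i Y_j + ∂_j Y_i` of the Euclidean metric. -/
def lieMetric (Y : Euc m → Euc m) (i j : Fin m) (x : Euc m) : ℝ :=
  pderiv i (fun z => Y z j) x + pderiv j (fun z => Y z i) x

/-- Criticality with respect to the variations of the domain metric by diffeomorphisms:
`∫ k^{ij} S_ij dV = 0` for `k = L_Y g`, with `Y` any smooth compactly supported vector field. -/
def IsStationary (δ₁ δ₂ : ℝ) : Prop :=
  ∀ Y : Euc m → Euc m, ContDiff ℝ ∞ Y → HasCompactSupport Y →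
    stressPairing N φ δ₁ δ₂ (lieMetric Y) = 0

/-- Criticality with respect to all variations of the domain metric: `∫ k^{ij} S_ij dV = 0` for
every smooth compactly supported symmetric 2-tensor `k`. -/
def IsMetricStationary (δ₁ δ₂ : ℝ) : Prop :=
  ∀ k : Fin m → Fin m → Euc m → ℝ, (∀ i j, ContDiff ℝ ∞ (k i j)) →
    (∀ i j, HasCompactSupport (k i j)) → (∀ i j, k i j = k j i) →
    stressPairing N φ δ₁ δ₂ k = 0

/-- Criticality for all metric variations is the stronger of the two notions. -/
theorem IsMetricStationary.isStationary {N : Set (Euc q)} {φ : Euc m → Euc q} {δ₁ δ₂ : ℝ}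
    (h : IsMetricStationary N φ δ₁ δ₂) : IsStationary N φ δ₁ δ₂ := by
  intro Y hY hYc
  have hc : ∀ j : Fin m, ContDiff ℝ ∞ (fun z => Y z j) := fun j =>
    (contDiff_euclidean.1 hY) j
  have hs : ∀ j : Fin m, HasCompactSupport (fun z => Y z j) := fun j =>
    hYc.comp_left (g := fun w : Euc m => w j) rfl
  have hd : ∀ i j : Fin m, ContDiff ℝ ∞ (pderiv i (fun z => Y z j)) := fun i j =>
    ((hc j).fderiv_right (m := ∞) (by simp)).clm_apply contDiff_const
  have hds : ∀ i j : Fin m, HasCompactSupport (pderiv i (fun z => Y z j)) := fun i j =>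
    (hs j).fderiv_apply ℝ (stdVec i)
  refine h (lieMetric Y) (fun i j => (hd i j).add (hd j i)) (fun i j => (hds i j).add (hds j i)) ?_
  intro i j
  funext x
  exact add_comm _ _

/-- `φ` is harmonic: `τ(φ) = 0`. -/
def IsHarmonic : Prop := ∀ᵐ x, tension N φ x = 0

/-- `φ` is trivial: it is (almost everywhere equal to) a constant map to a point of `N`. -/
def IsTrivial : Prop := ∃ c ∈ N, ∀ᵐ x, φ x = c

end Maps

end

end SesquiHarmonic

namespace SesquiHarmonic

/-! ### Continuity of the tangential projection on a submanifold. -/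

section Geometry

open scoped InnerProductSpace

variable {E G : Type*} [NormedAddCommGroup E] [InnerProductSpace ℝ E] [FiniteDimensional ℝ E]
  [NormedAddCommGroup G] [InnerProductSpace ℝ G] [FiniteDimensional ℝ G]

/-! The proof is a Pohozaev-type argument: stationarity is tested with cut-off dilation fields. Let
`Y` be smooth, compactly supported and equal to `x ↦ x` near the origin, and put `Y_c(x) = c⁻¹ Y(c
x)`. Then `L_{Y_c} g (x) = (L_Y g)(c x)`, which stays bounded and tends to `2 δ_ij` as `c → 0`,
while its first derivatives carry a factor `c` and vanish in the limit. Finite energy makes every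
quadratic expression in `dφ`, `∇̄dφ`, `τ` integrable, so dominated convergence applies
(`tendsto_stressPairing_comp_smul`) and yields (`integral_energy_identity`) `δ₁ (4 - 2m) ∫|dφ|² + δ₂
(8 - 2m) ∫|τ|² = 0`.

In each case the signs force one integral to vanish. If it is `∫|τ|²`, the map is harmonic; if it is
`∫|dφ|²`, the weak gradient is zero and mollification shows that `φ` is constant
(`ae_eq_const_of_weakPartial_eq_zero`).

The geometry of `N` enters only through measurability of `∇̄dφ = P_φ(∂∂φ)`, which follows from
continuity of `y ↦ P_y` on `N` (`continuousOn_tangentProj`). -/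

theorem isUnit_adjoint_comp_self_of_injective (B : G →L[ℝ] E) (hB : Function.Injective B) :
    IsUnit (ContinuousLinearMap.adjoint B ∘L B) := by
  have : Function.Injective (ContinuousLinearMap.adjoint B ∘L B) := by
    rw [injective_iff_map_eq_zero]
    intro v hv
    apply hB
    rw [map_zero, ← inner_self_eq_zero (𝕜 := ℝ), ← ContinuousLinearMap.adjoint_inner_left]
    rw [ContinuousLinearMap.comp_apply] at hv
    rw [hv, inner_zero_left]
  rw [ContinuousLinearMap.isUnit_iff_bijective]
  exact ⟨this, LinearMap.injective_iff_surjective.1 this⟩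

/-- The orthogonal projection onto the range of an injective map `B` is `B (B* B)⁻¹ B*`. -/
theorem starProjection_eq_of_range (B : G →L[ℝ] E) (hB : Function.Injective B)
    (K : Submodule ℝ E) (hK : K = LinearMap.range B.toLinearMap) :
    K.starProjection = B ∘L (Ring.inverse (ContinuousLinearMap.adjoint B ∘L B) ∘L
      ContinuousLinearMap.adjoint B) := by
  ext1 u
  apply Submodule.eq_starProjection_of_mem_orthogonal
  · rw [hK]
    exact ⟨_, rfl⟩
  · rw [Submodule.mem_orthogonal]
    intro w hw
    rw [hK] at hw
    obtain ⟨f, rfl⟩ := hw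
    -- Since `(B* B)(B* B)⁻¹ B* u = B* u`, the adjoint `B*` kills the residual, so the residual is
    -- orthogonal to the range.
    have h := Ring.mul_inverse_cancel _ (isUnit_adjoint_comp_self_of_injective B hB)
    have h' := congrArg (fun T : G →L[ℝ] G => T (ContinuousLinearMap.adjoint B u)) h
    simp only [mul_apply_eq_comp, ContinuousLinearMap.comp_apply,
      one_apply_eq_self] at h'
    change ⟪B f, _⟫_ℝ = 0
    rw [← ContinuousLinearMap.adjoint_inner_right, map_sub]
    simp only [ContinuousLinearMap.comp_apply]
    rw [h', sub_self, inner_zero_right]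

/-- The orthogonal projection onto the range of an injective map depends continuously on it. -/
theorem continuousAt_range_starProjection_formula (B : G →L[ℝ] E) (hB : Function.Injective B) :
    ContinuousAt (fun B : G →L[ℝ] E => B ∘L (Ring.inverse (ContinuousLinearMap.adjoint B ∘L B) ∘L
      ContinuousLinearMap.adjoint B)) B := by
  have hadj : Continuous fun B : G →L[ℝ] E => ContinuousLinearMap.adjoint B :=
    ContinuousLinearMap.adjoint.continuous
  obtain ⟨u, hu⟩ := isUnit_adjoint_comp_self_of_injective B hB
  have h1 : ContinuousAt (fun B : G →L[ℝ] E => ContinuousLinearMap.adjoint B ∘L B) B :=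
    (hadj.clm_comp continuous_id).continuousAt
  have h2 : ContinuousAt (Ring.inverse : (G →L[ℝ] G) → (G →L[ℝ] G))
      (ContinuousLinearMap.adjoint B ∘L B) := by
    rw [← hu]; exact NormedRing.inverse_continuousAt u
  have h3 := ContinuousAt.comp (f := fun B : G →L[ℝ] E => ContinuousLinearMap.adjoint B ∘L B) h2 h1
  exact continuousAt_id.clm_comp (h3.clm_comp hadj.continuousAt)

variable {q : ℕ} {N : Set (Euc q)}

/-- In a submanifold chart `e` the tangent space is the image of the model subspace under the
derivative of `e.symm`. -/
theorem tangentSpace_eq_map {e : OpenPartialHomeomorph (Euc q) (Euc q)}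
    {F : Submodule ℝ (Euc q)} (he : ContDiffOn ℝ ∞ e e.source)
    (he' : ContDiffOn ℝ ∞ e.symm e.target) (hF : ∀ z ∈ e.source, (z ∈ N ↔ e z ∈ F))
    {z : Euc q} (hz : z ∈ e.source) (hzN : z ∈ N) :
    tangentSpace N z = F.map (fderiv ℝ e.symm (e z)).toLinearMap := by
  have hd : HasFDerivAt e (fderiv ℝ e z) z :=
    ((he.contDiffAt (e.open_source.mem_nhds hz)).differentiableAt (by simp)).hasFDerivAt
  have hd' : HasFDerivAt e.symm (fderiv ℝ e.symm (e z)) (e z) :=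
    ((he'.contDiffAt (e.open_target.mem_nhds (e.map_source hz))).differentiableAt
      (by simp)).hasFDerivAt
  apply le_antisymm
  · refine Submodule.span_le.2 ?_
    rintro v ⟨γ, h0, hγN, hγ⟩
    subst h0
    have hγs : ∀ᶠ t in 𝓝 (0 : ℝ), γ t ∈ e.source :=
      hγ.continuousAt.eventually_mem (e.open_source.mem_nhds hz)
    have h1 : HasDerivAt (e ∘ γ) (fderiv ℝ e (γ 0) v) 0 := hd.comp_hasDerivAt 0 hγ
    have h2 : HasDerivAt (e.symm ∘ (e ∘ γ)) (fderiv ℝ e.symm (e (γ 0)) (fderiv ℝ e (γ 0) v)) 0 :=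
      HasFDerivAt.comp_hasDerivAt (0 : ℝ) hd' h1
    have h3 : e.symm ∘ (e ∘ γ) =ᶠ[𝓝 0] γ := by
      filter_upwards [hγs] with t ht using e.left_inv ht
    -- In the chart the curve stays in `F`, so its `Fᗮ` component is zero near `0`; differentiating
    -- puts the chart velocity in `F`.
    have h4 : HasDerivAt (Fᗮ.starProjection ∘ (e ∘ γ))
        (Fᗮ.starProjection (fderiv ℝ e (γ 0) v)) 0 :=
      (Fᗮ.starProjection).hasFDerivAt.comp_hasDerivAt 0 h1
    have h5 : Fᗮ.starProjection ∘ (e ∘ γ) =ᶠ[𝓝 0] fun _ => 0 := by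
      filter_upwards [hγs, hγN] with t ht htN
      simp only [Function.comp_apply]
      rw [Submodule.starProjection_apply_eq_zero_iff, Submodule.orthogonal_orthogonal]
      exact (hF _ ht).1 htN
    have h6 := h4.unique ((hasDerivAt_const (0 : ℝ) (0 : Euc q)).congr_of_eventuallyEq h5)
    rw [Submodule.starProjection_apply_eq_zero_iff, Submodule.orthogonal_orthogonal] at h6
    exact ⟨_, h6, h2.unique (hγ.congr_of_eventuallyEq h3)⟩
  · rintro _ ⟨w, hw, rfl⟩
    apply Submodule.subset_span
    -- Conversely, the chart carries the straight line through `e z` in direction `w ∈ F` back to a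
    -- curve in `N`.
    have hl : HasDerivAt (fun t : ℝ => e z + t • w) w 0 := by
      simpa using ((hasDerivAt_id (0 : ℝ)).smul_const w).const_add (e z)
    have hl0 : e z + (0 : ℝ) • w = e z := by simp
    refine ⟨fun t => e.symm (e z + t • w), by simp [e.left_inv hz], ?_, ?_⟩
    · have : ∀ᶠ t in 𝓝 (0 : ℝ), e z + t • w ∈ e.target := by
        refine hl.continuousAt.eventually_mem (e.open_target.mem_nhds ?_)
        rw [hl0]; exact e.map_source hz
      filter_upwards [this] with t ht
      rw [hF _ (e.map_target ht), e.right_inv ht]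
      exact F.add_mem ((hF z hz).1 hzN) (F.smul_mem _ hw)
    · exact HasFDerivAt.comp_hasDerivAt (f := fun t : ℝ => e z + t • w) (0 : ℝ) (by rwa [hl0]) hl

theorem fderiv_symm_injective {e : OpenPartialHomeomorph (Euc q) (Euc q)}
    (he : ContDiffOn ℝ ∞ e e.source) (he' : ContDiffOn ℝ ∞ e.symm e.target)
    {z : Euc q} (hz : z ∈ e.source) : Function.Injective (fderiv ℝ e.symm (e z)) := by
  have hd : HasFDerivAt e (fderiv ℝ e z) (e.symm (e z)) := by
    rw [e.left_inv hz]
    exact ((he.contDiffAt (e.open_source.mem_nhds hz)).differentiableAt (by simp)).hasFDerivAt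
  have hd' : HasFDerivAt e.symm (fderiv ℝ e.symm (e z)) (e z) :=
    ((he'.contDiffAt (e.open_target.mem_nhds (e.map_source hz))).differentiableAt
      (by simp)).hasFDerivAt
  have h1 := hd.comp (e z) hd'
  have h2 : e ∘ e.symm =ᶠ[𝓝 (e z)] id := by
    filter_upwards [e.open_target.mem_nhds (e.map_source hz)] with w hw using e.right_inv hw
  have h3 := h1.unique ((hasFDerivAt_id (𝕜 := ℝ) (e z)).congr_of_eventuallyEq h2)
  refine Function.LeftInverse.injective (g := fderiv ℝ e z) fun v => ?_
  exact congrArg (fun T : Euc q →L[ℝ] Euc q => T v) h3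

/-- Locally `T_z N` is the range of an injective map depending continuously on `z`, and `B (B* B)⁻¹
B*` is continuous in `B` there. -/
theorem continuousOn_tangentProj {n : ℕ} (hN : IsSmoothSubmanifold n N) :
    ContinuousOn (tangentProj N) N := by
  intro y hy
  obtain ⟨e, F, hys, he, he', -, hF⟩ := hN y hy
  let B : Euc q → (F →L[ℝ] Euc q) := fun z => fderiv ℝ e.symm (e z) ∘L F.subtypeL
  have hBinj : ∀ z ∈ e.source, Function.Injective (B z) := fun z hz =>
    (fderiv_symm_injective he he' hz).comp Subtype.val_injective
  have hB : ContinuousAt B y := by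
    have h1 : ContinuousAt (fderiv ℝ e.symm) (e y) :=
      ((he'.contDiffAt (e.open_target.mem_nhds (e.map_source hys))).fderiv_right
        (m := ∞) (by simp)).continuousAt
    exact (h1.comp (e.continuousAt hys)).clm_comp continuousAt_const
  have hform := ContinuousAt.comp (f := B)
    (continuousAt_range_starProjection_formula (B y) (hBinj y hys)) hB
  have heq : ∀ z ∈ e.source, z ∈ N → tangentProj N z = B z ∘L
      (Ring.inverse (ContinuousLinearMap.adjoint (B z) ∘L B z) ∘L
        ContinuousLinearMap.adjoint (B z)) := by
    intro z hz hzN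
    refine starProjection_eq_of_range (B z) (hBinj z hz) _ ?_
    rw [tangentSpace_eq_map he he' hF hz hzN]
    ext w
    simp [B]
  refine hform.continuousWithinAt.congr_of_eventuallyEq ?_ (heq y hys hy)
  filter_upwards [self_mem_nhdsWithin,
    mem_nhdsWithin_of_mem_nhds (e.open_source.mem_nhds hys)] with z hzN hz using heq z hz hzN

end Geometry

/-- Composition of a function continuous on a set with an a.e. measurable function that takes
values in this set almost everywhere. -/
theorem aestronglyMeasurable_comp_of_continuousOn {α X Y : Type*} [MeasurableSpace α]
    {μ : Measure α} [TopologicalSpace X] [MeasurableSpace X] [BorelSpace X]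
    [SecondCountableTopology X] [TopologicalSpace Y] [TopologicalSpace.PseudoMetrizableSpace Y]
    {s : Set X} {f : X → Y} (hf : ContinuousOn f s) {g : α → X} (hg : AEMeasurable g μ)
    (hgs : ∀ᵐ x ∂μ, g x ∈ s) : AEStronglyMeasurable (fun x => f (g x)) μ := by
  rcases s.eq_empty_or_nonempty with rfl | ⟨y, hy⟩
  · have : μ = 0 := by simpa using hgs
    subst this
    exact aestronglyMeasurable_zero_measure _
  -- A measurable version with values in `s` everywhere factors through the subtype, on which `f` is
  -- continuous; `s` itself need not be measurable.
  obtain ⟨g', hg'm, hg's, hgg'⟩ := hg.exists_ae_eq_range_subset hgs ⟨y, hy⟩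
  have h1 : Measurable (fun x => (⟨g' x, hg's ⟨x, rfl⟩⟩ : s)) := hg'm.subtype_mk
  have h2 : StronglyMeasurable (fun x => f (g' x)) :=
    (continuousOn_iff_continuous_domRestrict.1 hf).stronglyMeasurable.comp_measurable h1
  refine ⟨_, h2, ?_⟩
  filter_upwards [hgg'] with x hx
  rw [hx]

/-! ### Vanishing weak gradient implies constancy. -/

section Constancy

open scoped Convolution

variable {m q : ℕ}

theorem clm_eq_zero_of_stdVec {E : Type*} [NormedAddCommGroup E] [NormedSpace ℝ E]
    (T : Euc m →L[ℝ] E) (h : ∀ i, T (stdVec i) = 0) : T = 0 := by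
  have : T.toLinearMap = 0 := by
    refine (EuclideanSpace.basisFun (Fin m) ℝ).toBasis.ext fun i => ?_
    simpa [stdVec] using h i
  ext1 v
  exact congrArg (fun S : Euc m →ₗ[ℝ] E => S v) this

/-- The mollification of a function with vanishing weak gradient is constant. -/
theorem convolution_const_of_weakPartial_eq_zero {u : Euc m → Euc q}
    (hu : LocallyIntegrable u volume)
    (h0 : ∀ (i : Fin m) (η : Euc m → ℝ), ContDiff ℝ ∞ η → HasCompactSupport η →
      ∫ x, pderiv i η x • u x = 0)
    {ρ : Euc m → ℝ} (hρ : ContDiff ℝ ∞ ρ) (hρc : HasCompactSupport ρ) (x y : Euc m) :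
    (ρ ⋆[ContinuousLinearMap.lsmul ℝ ℝ, volume] u) x =
      (ρ ⋆[ContinuousLinearMap.lsmul ℝ ℝ, volume] u) y := by
  have hd := fun x => hρc.hasFDerivAt_convolution_left (ContinuousLinearMap.lsmul ℝ ℝ)
    (hρ.of_le (by simp)) hu x
  refine is_const_of_fderiv_eq_zero (𝕜 := ℝ) (fun x => (hd x).differentiableAt) (fun x => ?_) x y
  rw [(hd x).fderiv]
  apply clm_eq_zero_of_stdVec
  intro i
  have hex := (hρc.fderiv ℝ).convolutionExists_left
    ((ContinuousLinearMap.lsmul ℝ ℝ).precompL (Euc m) : _ →L[ℝ] Euc q →L[ℝ] _)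
    (hρ.continuous_fderiv (by simp)) hu x
  rw [convolution_eq_swap, ContinuousLinearMap.integral_apply hex.integrable_swap]
  -- The derivative of the mollification at `x` is, up to sign, the pairing of `u` with a derivative
  -- of the test function `t ↦ ρ (x - t)`.
  have hη : ContDiff ℝ ∞ (fun t => ρ (x - t)) := hρ.comp (contDiff_const.sub contDiff_id)
  have hηc : HasCompactSupport (fun t => ρ (x - t)) :=
    hρc.comp_homeomorph (Homeomorph.subLeft x)
  have := h0 i _ hη hηc
  rw [← neg_eq_zero, ← integral_neg, ← this]
  refine integral_congr_ae (Eventually.of_forall fun t => ?_)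
  have h1 : pderiv i (fun t => ρ (x - t)) t = - fderiv ℝ ρ (x - t) (stdVec i) := by
    unfold pderiv
    have h2 := ((hρ.differentiable (by simp)) (x - t)).hasFDerivAt.comp t
      ((hasFDerivAt_const x t).sub (hasFDerivAt_id (𝕜 := ℝ) t))
    have h3 : fderiv ℝ (fun t => ρ (x - t)) t = _ := h2.fderiv
    rw [h3]
    simp
  simp [h1]

/-- A function on `ℝ^m` with vanishing weak gradient is almost everywhere constant. -/
theorem ae_eq_const_of_weakPartial_eq_zero {u : Euc m → Euc q}
    (hu : LocallyIntegrable u volume)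
    (h0 : ∀ (i : Fin m) (η : Euc m → ℝ), ContDiff ℝ ∞ η → HasCompactSupport η →
      ∫ x, pderiv i η x • u x = 0) : ∃ c, ∀ᵐ x, u x = c := by
  -- The radii shrink to zero with fixed ratio `2`, as almost everywhere convergence of the
  -- mollifications requires (`K := 2`).
  let b : ℕ → ContDiffBump (0 : Euc m) := fun n =>
    { rIn := 1 / ((n : ℝ) + 1)
      rOut := 2 * (1 / ((n : ℝ) + 1))
      rIn_pos := by positivity
      rIn_lt_rOut := by
        have : 0 < 1 / ((n : ℝ) + 1) := by positivity
        linarith }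
  have hlim : Tendsto (fun n => (b n).rOut) atTop (𝓝 0) := by
    simpa [b] using (tendsto_one_div_add_atTop_nhds_zero_nat (𝕜 := ℝ)).const_mul 2
  have hae := ContDiffBump.ae_convolution_tendsto_right_of_locallyIntegrable (K := 2)
    (μ := volume) hlim (Eventually.of_forall fun n => le_rfl) hu
  obtain ⟨x₀, hx₀⟩ := hae.exists
  refine ⟨u x₀, ?_⟩
  filter_upwards [hae] with x hx
  refine tendsto_nhds_unique hx (hx₀.congr fun n => ?_)
  exact convolution_const_of_weakPartial_eq_zero hu h0 (b n).contDiff_normed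
    (b n).hasCompactSupport_normed _ _

end Constancy

/-! ### Dominated convergence and rescaled test tensors. -/

section Convergence

variable {m : ℕ}

/-- All `F n` and `f` are integrable, and the integrals of `F n` converge to that of `f`. -/
def IntegralsConverge (F : ℕ → Euc m → ℝ) (f : Euc m → ℝ) : Prop :=
  (∀ n, Integrable (F n) volume) ∧ Integrable f volume ∧
    Tendsto (fun n => ∫ x, F n x) atTop (𝓝 (∫ x, f x))

namespace IntegralsConverge

variable {F G : ℕ → Euc m → ℝ} {f g : Euc m → ℝ}

theorem add (hF : IntegralsConverge F f) (hG : IntegralsConverge G g) :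
    IntegralsConverge (fun n x => F n x + G n x) (fun x => f x + g x) := by
  refine ⟨fun n => (hF.1 n).add (hG.1 n), hF.2.1.add hG.2.1, ?_⟩
  simp_rw [fun n => integral_add (hF.1 n) (hG.1 n)]
  rw [integral_add hF.2.1 hG.2.1]
  exact hF.2.2.add hG.2.2

theorem const_mul (c : ℝ) (hF : IntegralsConverge F f) :
    IntegralsConverge (fun n x => c * F n x) (fun x => c * f x) := by
  refine ⟨fun n => (hF.1 n).const_mul c, hF.2.1.const_mul c, ?_⟩
  simp_rw [integral_const_mul]
  exact hF.2.2.const_mul c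

theorem sub (hF : IntegralsConverge F f) (hG : IntegralsConverge G g) :
    IntegralsConverge (fun n x => F n x - G n x) (fun x => f x - g x) := by
  refine ⟨fun n => (hF.1 n).sub (hG.1 n), hF.2.1.sub hG.2.1, ?_⟩
  simp_rw [fun n => integral_sub (hF.1 n) (hG.1 n)]
  rw [integral_sub hF.2.1 hG.2.1]
  exact hF.2.2.sub hG.2.2

theorem sum {ι : Type*} [Fintype ι] {F : ι → ℕ → Euc m → ℝ} {f : ι → Euc m → ℝ}
    (h : ∀ i, IntegralsConverge (F i) (f i)) :
    IntegralsConverge (fun n x => ∑ i, F i n x) (fun x => ∑ i, f i x) := by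
  refine ⟨fun n => integrable_finsetSum _ fun i _ => (h i).1 n,
    integrable_finsetSum _ fun i _ => (h i).2.1, ?_⟩
  simp_rw [fun n => integral_finsetSum Finset.univ fun i _ => (h i).1 n]
  rw [integral_finsetSum Finset.univ fun i _ => (h i).2.1]
  exact tendsto_finsetSum _ fun i _ => (h i).2.2

end IntegralsConverge

/-- A uniformly bounded sequence of continuous functions that converges pointwise to the
constant `b`. -/
def BoundedlyConverges (a : ℕ → Euc m → ℝ) (b : ℝ) : Prop :=
  (∀ n, Continuous (a n)) ∧ (∃ C, ∀ n x, ‖a n x‖ ≤ C) ∧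
    ∀ x, Tendsto (fun n => a n x) atTop (𝓝 b)

theorem BoundedlyConverges.sum {ι : Type*} [Fintype ι] {a : ι → ℕ → Euc m → ℝ} {b : ι → ℝ}
    (h : ∀ i, BoundedlyConverges (a i) (b i)) :
    BoundedlyConverges (fun n x => ∑ i, a i n x) (∑ i, b i) := by
  choose C hC using fun i => (h i).2.1
  exact ⟨fun n => continuous_finsetSum _ fun i _ => (h i).1 n,
    ⟨∑ i, C i, fun n x => norm_sum_le_of_le _ fun i _ => hC i n x⟩,
    fun x => tendsto_finsetSum _ fun i _ => (h i).2.2 x⟩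

theorem BoundedlyConverges.mul_integrable {a : ℕ → Euc m → ℝ} {b : ℝ}
    (ha : BoundedlyConverges a b) {f : Euc m → ℝ} (hf : Integrable f volume) :
    IntegralsConverge (fun n x => a n x * f x) (fun x => b * f x) := by
  obtain ⟨hc, ⟨C, hC⟩, hlim⟩ := ha
  have hint : ∀ n, Integrable (fun x => a n x * f x) volume := fun n =>
    hf.bdd_mul (hc n).aestronglyMeasurable (Eventually.of_forall (hC n))
  refine ⟨hint, hf.const_mul b, ?_⟩
  refine tendsto_integral_of_dominated_convergence (fun x => C * ‖f x‖)
    (fun n => (hint n).aestronglyMeasurable) (hf.norm.const_mul C) (fun n => ?_) ?_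
  · refine Eventually.of_forall fun x => ?_
    rw [norm_mul]
    exact mul_le_mul_of_nonneg_right (hC n x) (norm_nonneg _)
  · exact Eventually.of_forall fun x => (hlim x).mul_const _

theorem pderiv_comp_smul (i : Fin m) (f : Euc m → ℝ) (c : ℝ) (x : Euc m) :
    pderiv i (fun z => f (c • z)) x = c * pderiv i f (c • x) := by
  unfold pderiv
  rw [show fderiv ℝ (fun z => f (c • z)) x = c • fderiv ℝ f (c • x) from fderiv_comp_smul c]
  simp

theorem contDiff_pderiv {f : Euc m → ℝ} (hf : ContDiff ℝ ∞ f) (i : Fin m) :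
    ContDiff ℝ ∞ (pderiv i f) :=
  (hf.fderiv_right (m := ∞) (by simp)).clm_apply contDiff_const

theorem hasCompactSupport_pderiv {f : Euc m → ℝ} (hf : HasCompactSupport f) (i : Fin m) :
    HasCompactSupport (pderiv i f) := hf.fderiv_apply ℝ (stdVec i)

theorem boundedlyConverges_comp_smul {f : Euc m → ℝ} (hf : Continuous f)
    (hfc : HasCompactSupport f) {c : ℕ → ℝ} (hc : Tendsto c atTop (𝓝 0)) :
    BoundedlyConverges (fun n x => f (c n • x)) (f 0) := by
  obtain ⟨C, hC⟩ := hfc.exists_bound_of_continuous hf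
  refine ⟨fun n => hf.comp (continuous_const_smul _), ⟨C, fun n x => hC _⟩, fun x => ?_⟩
  have h : Tendsto (fun n => c n • x) atTop (𝓝 0) := by simpa using hc.smul_const x
  exact (hf.tendsto 0).comp h

/-- The chain rule produces the factor `c n → 0`, which removes the derivative terms of the cut-off
in the limit. -/
theorem boundedlyConverges_pderiv_comp_smul {f : Euc m → ℝ} (hf : ContDiff ℝ ∞ f)
    (hfc : HasCompactSupport f) (i : Fin m) {c : ℕ → ℝ} (hc : Tendsto c atTop (𝓝 0)) :
    BoundedlyConverges (fun n x => pderiv i (fun z => f (c n • z)) x) 0 := by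
  obtain ⟨h1, ⟨C, hC⟩, h3⟩ := boundedlyConverges_comp_smul (contDiff_pderiv hf i).continuous
    (hasCompactSupport_pderiv hfc i) hc
  obtain ⟨M, hM⟩ := hc.norm.bddAbove_range
  simp_rw [pderiv_comp_smul]
  refine ⟨fun n => continuous_const.mul (h1 n), ⟨M * C, fun n x => ?_⟩, fun x => ?_⟩
  · rw [norm_mul]
    exact mul_le_mul (hM ⟨n, rfl⟩) (hC n x) (norm_nonneg _)
      ((norm_nonneg _).trans (hM ⟨n, rfl⟩))
  · simpa using hc.mul (h3 x)

/-- The outer `c⁻¹` cancels the chain-rule factor, so rescaled Lie derivatives are again Lie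
derivatives, to which stationarity applies. -/
theorem lieMetric_smul_comp_smul (Y : Euc m → Euc m) (hY : Differentiable ℝ Y) {c : ℝ}
    (hc : c ≠ 0) (i j : Fin m) :
    lieMetric (fun z => c⁻¹ • Y (c • z)) i j = fun x => lieMetric Y i j (c • x) := by
  have key : ∀ (i j : Fin m) (x : Euc m),
      pderiv i (fun z => (c⁻¹ • Y (c • z)) j) x = pderiv i (fun z => Y z j) (c • x) := by
    intro i j x
    have h1 : pderiv i (fun z => (c⁻¹ • Y (c • z)) j) x =
        c⁻¹ * pderiv i (fun z => Y (c • z) j) x := by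
      unfold pderiv
      have hd : DifferentiableAt ℝ (fun z => Y (c • z) j) x :=
        (differentiable_euclidean.1 hY j).comp (differentiable_id.const_smul c) x
      have : fderiv ℝ (fun z => (c⁻¹ • Y (c • z)) j) x =
          c⁻¹ • fderiv ℝ (fun z => Y (c • z) j) x := fderiv_const_smul hd c⁻¹
      rw [this]
      simp
    rw [h1, pderiv_comp_smul i (fun z => Y z j), ← mul_assoc, inv_mul_cancel₀ hc, one_mul]
  funext x
  simp only [lieMetric, key]

/-- A smooth compactly supported vector field that agrees near the origin with the radial field
has Lie derivative `2 δ_ij` at the origin. -/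
theorem lieMetric_radial_zero {Y : Euc m → Euc m} (hY : Y =ᶠ[𝓝 0] id) (i j : Fin m) :
    lieMetric Y i j 0 = if i = j then 2 else 0 := by
  have key : ∀ i j : Fin m, pderiv i (fun z => Y z j) 0 = if i = j then 1 else 0 := by
    intro i j
    unfold pderiv
    have h : (fun z => Y z j) =ᶠ[𝓝 0] fun z : Euc m => EuclideanSpace.proj (𝕜 := ℝ) j z := by
      filter_upwards [hY] with z hz
      simp [hz]
    rw [h.fderiv_eq, ContinuousLinearMap.fderiv]
    simp [stdVec, PiLp.single_apply, eq_comm]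
  simp only [lieMetric, key]
  by_cases h : i = j
  · subst h; norm_num
  · simp [h, Ne.symm h]

end Convergence

/-! ### Integrability from finite energy, and the energy identity. -/

section Energy

variable {m n q : ℕ} {N : Set (Euc q)} {φ : Euc m → Euc q}

theorem normSqDeriv_nonneg (φ : Euc m → Euc q) (x : Euc m) : 0 ≤ normSqDeriv φ x :=
  Finset.sum_nonneg fun _ _ => sq_nonneg _

theorem normSqSecondDeriv_nonneg (N : Set (Euc q)) (φ : Euc m → Euc q) (x : Euc m) :
    0 ≤ normSqSecondDeriv N φ x :=
  Finset.sum_nonneg fun _ _ => Finset.sum_nonneg fun _ _ => sq_nonneg _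

theorem MemW22loc.aestronglyMeasurable_secondDeriv (hN : IsSmoothSubmanifold n N)
    (hφ : MemW22loc N φ) (hm : 0 < m) (j i : Fin m) :
    AEStronglyMeasurable (secondDeriv N φ j i) volume := by
  -- Measurability of `φ` is read off from one of its weak partials, hence the need for an index.
  have h1 : AEStronglyMeasurable φ volume :=
    (hφ.hasWeakPartial ⟨0, hm⟩).1.aestronglyMeasurable
  have h2 := aestronglyMeasurable_comp_of_continuousOn (continuousOn_tangentProj hN)
    h1.aemeasurable hφ.mem
  exact (ContinuousLinearMap.id ℝ (Euc q →L[ℝ] Euc q)).aestronglyMeasurable_comp₂ h2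
    (hφ.hasWeakPartial_second i j).2.1.aestronglyMeasurable

theorem MemW22loc.memLp_weakPartial (hφ : MemW22loc N φ)
    (hfin : Integrable (fun x => normSqDeriv φ x + normSqSecondDeriv N φ x) volume) (i : Fin m) :
    MemLp (weakPartial i φ) 2 volume := by
  have h := (hφ.hasWeakPartial i).2.1.aestronglyMeasurable
  rw [memLp_two_iff_integrable_sq_norm h]
  refine hfin.mono' (h.norm.pow 2) (Eventually.of_forall fun x => ?_)
  have h1 : ‖weakPartial i φ x‖ ^ 2 ≤ normSqDeriv φ x :=
    Finset.single_le_sum (f := fun i => ‖weakPartial i φ x‖ ^ 2) (fun _ _ => sq_nonneg _)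
      (Finset.mem_univ i)
  have h2 : 0 ≤ normSqSecondDeriv N φ x := normSqSecondDeriv_nonneg N φ x
  rw [Real.norm_of_nonneg (sq_nonneg _)]
  linarith

theorem MemW22loc.memLp_secondDeriv (hN : IsSmoothSubmanifold n N) (hφ : MemW22loc N φ)
    (hfin : Integrable (fun x => normSqDeriv φ x + normSqSecondDeriv N φ x) volume)
    (j i : Fin m) : MemLp (secondDeriv N φ j i) 2 volume := by
  have h := hφ.aestronglyMeasurable_secondDeriv hN i.pos j i
  rw [memLp_two_iff_integrable_sq_norm h]
  refine hfin.mono' (h.norm.pow 2) (Eventually.of_forall fun x => ?_)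
  have h1 : ‖secondDeriv N φ j i x‖ ^ 2 ≤ ∑ j, ‖secondDeriv N φ j i x‖ ^ 2 :=
    Finset.single_le_sum (f := fun j => ‖secondDeriv N φ j i x‖ ^ 2) (fun _ _ => sq_nonneg _)
      (Finset.mem_univ j)
  have h2 : ∑ j, ‖secondDeriv N φ j i x‖ ^ 2 ≤ normSqSecondDeriv N φ x :=
    Finset.single_le_sum (f := fun i => ∑ j, ‖secondDeriv N φ j i x‖ ^ 2)
      (fun _ _ => Finset.sum_nonneg fun _ _ => sq_nonneg _) (Finset.mem_univ i)
  have h3 : 0 ≤ normSqDeriv φ x := normSqDeriv_nonneg φ x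
  rw [Real.norm_of_nonneg (sq_nonneg _)]
  linarith

theorem MemW22loc.memLp_tension (hN : IsSmoothSubmanifold n N) (hφ : MemW22loc N φ)
    (hfin : Integrable (fun x => normSqDeriv φ x + normSqSecondDeriv N φ x) volume) :
    MemLp (tension N φ) 2 volume :=
  memLp_finsetSum _ fun i _ => hφ.memLp_secondDeriv hN hfin i i

theorem integrable_inner_of_memLp_two {u v : Euc m → Euc q} (hu : MemLp u 2 volume)
    (hv : MemLp v 2 volume) : Integrable (fun x => (inner ℝ (u x) (v x) : ℝ)) volume := by
  refine (hu.norm.integrable_mul hv.norm).mono' (hu.1.inner hv.1)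
    (Eventually.of_forall fun x => ?_)
  exact norm_inner_le_norm _ _

/-- The stress-energy pairings of the rescaled tensors `k (c n • ·)` converge to the pairing with
the constant tensor `k 0`. -/
theorem tendsto_stressPairing_comp_smul (hN : IsSmoothSubmanifold n N) (hφ : MemW22loc N φ)
    (hfin : Integrable (fun x => normSqDeriv φ x + normSqSecondDeriv N φ x) volume)
    (δ₁ δ₂ : ℝ) {k : Fin m → Fin m → Euc m → ℝ} (hk : ∀ i j, ContDiff ℝ ∞ (k i j))
    (hkc : ∀ i j, HasCompactSupport (k i j)) {c : ℕ → ℝ} (hc : Tendsto c atTop (𝓝 0)) :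
    Tendsto (fun n => stressPairing N φ δ₁ δ₂ (fun i j x => k i j (c n • x))) atTop
      (𝓝 (stressPairing N φ δ₁ δ₂ (fun i j _ => k i j 0))) := by
  have hd := hφ.memLp_weakPartial hfin
  have hs := hφ.memLp_secondDeriv hN hfin
  have ht := hφ.memLp_tension hN hfin
  have ck : ∀ i j, BoundedlyConverges (fun n x => k i j (c n • x)) (k i j 0) := fun i j =>
    boundedlyConverges_comp_smul (hk i j).continuous (hkc i j) hc
  have cd : ∀ l i j, BoundedlyConverges (fun n x => pderiv l (fun z => k i j (c n • z)) x)
      (0 : ℝ) := fun l i j => boundedlyConverges_pderiv_comp_smul (hk i j) (hkc i j) l hc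
  have hdsq : Integrable (normSqDeriv φ) volume :=
    integrable_finsetSum _ fun i _ => (hd i).norm.integrable_sq
  have tr := BoundedlyConverges.sum fun i => ck i i
  -- Term by term in the order of `stressPairing`: each summand is a boundedly convergent factor
  -- times a fixed integrable function.
  have main := ((((IntegralsConverge.sum fun i => IntegralsConverge.sum fun j =>
      (ck i j).mul_integrable ((integrable_inner_of_memLp_two (hd i) (hd j)).const_mul 2)).sub
      (tr.mul_integrable hdsq)).const_mul δ₁).sub
      ((tr.mul_integrable ht.norm.integrable_sq).const_mul δ₂)).sub
      ((IntegralsConverge.sum fun l => (BoundedlyConverges.sum fun i => cd l i i).mul_integrable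
        (integrable_inner_of_memLp_two (hd l) ht)).const_mul (2 * δ₂)) |>.add
      ((IntegralsConverge.sum fun i => IntegralsConverge.sum fun j =>
        ((((cd j i j).mul_integrable (integrable_inner_of_memLp_two (hd i) ht)).add
          ((ck i j).mul_integrable (integrable_inner_of_memLp_two (hs j i) ht))).add
          ((cd i i j).mul_integrable (integrable_inner_of_memLp_two (hd j) ht))).add
          ((ck i j).mul_integrable (integrable_inner_of_memLp_two (hs i j) ht))).const_mul (2 * δ₂))
  have hconst : ∀ (l i j : Fin m) (x : Euc m), pderiv l (fun _ : Euc m => k i j 0) x = 0 := by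
    intro l i j x
    simp [pderiv]
  unfold stressPairing
  simp only [hconst]
  exact main.2.2

/-- The stress-energy pairing with the constant tensor `2 δ_ij`. -/
theorem stressPairing_two_mul_delta (hN : IsSmoothSubmanifold n N) (hφ : MemW22loc N φ)
    (hfin : Integrable (fun x => normSqDeriv φ x + normSqSecondDeriv N φ x) volume)
    (δ₁ δ₂ : ℝ) :
    stressPairing N φ δ₁ δ₂ (fun i j _ => if i = j then 2 else 0) =
      δ₁ * (4 - 2 * m) * (∫ x, normSqDeriv φ x) +
        δ₂ * (8 - 2 * m) * ∫ x, ‖tension N φ x‖ ^ 2 := by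
  have hdsq : Integrable (normSqDeriv φ) volume :=
    integrable_finsetSum _ fun i _ => (hφ.memLp_weakPartial hfin i).norm.integrable_sq
  have htsq := (hφ.memLp_tension hN hfin).norm.integrable_sq
  rw [← integral_const_mul, ← integral_const_mul,
    ← integral_add (hdsq.const_mul _) (htsq.const_mul _)]
  unfold stressPairing
  refine integral_congr_ae (Eventually.of_forall fun x => ?_)
  have hconst : ∀ (l : Fin m) (c : ℝ), pderiv l (fun _ : Euc m => c) x = 0 :=
    fun l c => by simp [pderiv]
  -- Only the diagonal of `∇̄dφ` survives, with trace `τ`; its two symmetric copies give the `8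
  -- |τ|²`, and the trace `2m` of the tensor gives the terms in `m`.
  have hτ : ∑ i, (inner ℝ (secondDeriv N φ i i x) (tension N φ x) : ℝ) = ‖tension N φ x‖ ^ 2 := by
    rw [← sum_inner, ← real_inner_self_eq_norm_sq]
    rfl
  simp only [hconst, zero_mul, zero_add, add_zero, ite_mul, Finset.sum_add_distrib,
    Finset.sum_ite_eq, Finset.mem_univ, if_true, ← Finset.mul_sum, Finset.sum_const_zero,
    real_inner_self_eq_norm_sq, hτ, Finset.sum_const, Finset.card_univ, Fintype.card_fin,
    nsmul_eq_mul]
  change δ₁ * (2 * (2 * normSqDeriv φ x) - _) - _ - _ + _ = _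
  ring

/-- The limit of the stress-energy pairings with the Lie derivatives of cut-off radial fields. -/
theorem integral_energy_identity (hN : IsSmoothSubmanifold n N) (hφ : MemW22loc N φ)
    {δ₁ δ₂ : ℝ} (hstat : IsStationary N φ δ₁ δ₂)
    (hfin : Integrable (fun x => normSqDeriv φ x + normSqSecondDeriv N φ x) volume) :
    δ₁ * (4 - 2 * m) * (∫ x, normSqDeriv φ x) +
      δ₂ * (8 - 2 * m) * ∫ x, ‖tension N φ x‖ ^ 2 = 0 := by
  -- The radii are immaterial: only the behaviour of `Y` near the origin survives the rescaling.
  let b : ContDiffBump (0 : Euc m) := ⟨1, 2, one_pos, one_lt_two⟩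
  let Y : Euc m → Euc m := fun x => b x • x
  have hY : ContDiff ℝ ∞ Y := b.contDiff.smul contDiff_id
  have hYc : HasCompactSupport Y := b.hasCompactSupport.smul_right
  have hY0 : Y =ᶠ[𝓝 0] id := by
    filter_upwards [b.eventuallyEq_one] with x hx
    simp [Y, hx]
  have hYj : ∀ j : Fin m, ContDiff ℝ ∞ (fun z => Y z j) := contDiff_euclidean.1 hY
  have hYjc : ∀ j : Fin m, HasCompactSupport (fun z => Y z j) := fun j =>
    hYc.comp_left (g := fun w : Euc m => w j) rfl
  have hlim := tendsto_stressPairing_comp_smul hN hφ hfin δ₁ δ₂ (k := lieMetric Y)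
    (fun i j => (contDiff_pderiv (hYj j) i).add (contDiff_pderiv (hYj i) j))
    (fun i j => (hasCompactSupport_pderiv (hYjc j) i).add (hasCompactSupport_pderiv (hYjc i) j))
    (tendsto_one_div_add_atTop_nhds_zero_nat (𝕜 := ℝ))
  have hzero : ∀ l : ℕ, stressPairing N φ δ₁ δ₂
      (fun i j x => lieMetric Y i j ((1 / ((l : ℝ) + 1)) • x)) = 0 := by
    intro l
    have hl : 1 / ((l : ℝ) + 1) ≠ 0 := by positivity
    have := hstat (fun z => (1 / ((l : ℝ) + 1))⁻¹ • Y ((1 / ((l : ℝ) + 1)) • z))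
      ((hY.comp (contDiff_id.const_smul _)).const_smul _) ((hYc.comp_smul hl).smul_left
        (f := fun _ => (1 / ((l : ℝ) + 1))⁻¹))
    rwa [funext₂ (lieMetric_smul_comp_smul Y (hY.differentiable (by simp)) hl)] at this
  simp only [hzero, lieMetric_radial_zero hY0] at hlim
  rw [← stressPairing_two_mul_delta hN hφ hfin]
  exact (tendsto_nhds_unique hlim tendsto_const_nhds)

theorem isTrivial_of_integral_normSqDeriv_eq_zero (hφ : MemW22loc N φ) (hm : 0 < m)
    (hint : Integrable (normSqDeriv φ) volume) (h : ∫ x, normSqDeriv φ x = 0) :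
    IsTrivial N φ := by
  have h1 : normSqDeriv φ =ᵐ[volume] 0 :=
    (integral_eq_zero_iff_of_nonneg (fun x => normSqDeriv_nonneg φ x) hint).1 h
  have h2 : ∀ i, ∀ᵐ x, weakPartial i φ x = 0 := by
    intro i
    filter_upwards [h1] with x hx
    have := (Finset.sum_eq_zero_iff_of_nonneg (s := Finset.univ)
      (f := fun i => ‖weakPartial i φ x‖ ^ 2) (fun _ _ => sq_nonneg _)).1 hx i
      (Finset.mem_univ i)
    simpa using this
  obtain ⟨c, hc⟩ := ae_eq_const_of_weakPartial_eq_zero (hφ.hasWeakPartial ⟨0, hm⟩).1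
    (fun i η hη hηc => by
      rw [(hφ.hasWeakPartial i).2.2 η hη hηc, neg_eq_zero]
      refine integral_eq_zero_of_ae ?_
      filter_upwards [h2 i] with x hx
      simp [hx])
  -- Two full-measure conditions hold at a common point, which places the constant in `N`.
  obtain ⟨x, hx, hxN⟩ := (hc.and hφ.mem).exists
  exact ⟨c, hx ▸ hxN, hc⟩

end Energy

end SesquiHarmonic

/-! ### Sign discussion of the energy identity. -/

theorem mainTheorem3 (m n q : ℕ) (N : Set (SesquiHarmonic.Euc q))
    (hN : SesquiHarmonic.IsSmoothSubmanifold n N)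
    (φ : SesquiHarmonic.Euc m → SesquiHarmonic.Euc q)
    (hφ : SesquiHarmonic.MemW22loc N φ) (hφ_bdd : SesquiHarmonic.MemLinftyLoc φ)
    (δ₁ δ₂ : ℝ) (hδ₁ : δ₁ ≠ 0) (hδ₂ : δ₂ ≠ 0)
    (hsol : SesquiHarmonic.IsWeakSolution N φ δ₁ δ₂)
    (hstat : SesquiHarmonic.IsStationary N φ δ₁ δ₂)
    (hfin : MeasureTheory.Integrable
      (fun x => SesquiHarmonic.normSqDeriv φ x + SesquiHarmonic.normSqSecondDeriv N φ x)
      MeasureTheory.volume) :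
    (m = 1 → 0 < δ₁ → 0 < δ₂ → SesquiHarmonic.IsTrivial N φ) ∧
    (m = 2 → 0 < δ₂ → SesquiHarmonic.IsHarmonic N φ) ∧
    (m = 3 → δ₁ < 0 → 0 < δ₂ → SesquiHarmonic.IsTrivial N φ) ∧
    (m = 4 → δ₁ < 0 → SesquiHarmonic.IsTrivial N φ) ∧
    (5 ≤ m → δ₁ < 0 → δ₂ < 0 → SesquiHarmonic.IsTrivial N φ) := by
  have hid := SesquiHarmonic.integral_energy_identity hN hφ hstat hfin
  have hdsq : MeasureTheory.Integrable (SesquiHarmonic.normSqDeriv φ) MeasureTheory.volume :=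
    MeasureTheory.integrable_finsetSum _ fun i _ =>
      (hφ.memLp_weakPartial hfin i).norm.integrable_sq
  have htsq := (hφ.memLp_tension hN hfin).norm.integrable_sq
  have hA : 0 ≤ ∫ x, SesquiHarmonic.normSqDeriv φ x :=
    MeasureTheory.integral_nonneg (SesquiHarmonic.normSqDeriv_nonneg φ)
  have hB : 0 ≤ ∫ x, ‖SesquiHarmonic.tension N φ x‖ ^ 2 :=
    MeasureTheory.integral_nonneg fun x => sq_nonneg _
  have hfinish := fun hm => SesquiHarmonic.isTrivial_of_integral_normSqDeriv_eq_zero hφ hm hdsq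
  generalize (∫ x, SesquiHarmonic.normSqDeriv φ x) = A at *
  -- With `a > 0` and `b, B ≥ 0`, both summands are nonnegative, so `a * A` must vanish; `b = 0` is
  -- allowed for dimension four.
  have key : ∀ a b : ℝ, 0 < a → 0 ≤ b → ∀ {B : ℝ}, 0 ≤ B → a * A + b * B = 0 → A = 0 := by
    intro a b ha hb B hB h
    have h1 := mul_nonneg hb hB
    have h2 : a * A ≤ 0 := by linarith
    exact le_antisymm (nonpos_of_mul_nonpos_right h2 ha) hA
  refine ⟨?_, ?_, ?_, ?_, ?_⟩
  · rintro rfl h1 h2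
    refine hfinish one_pos (key (2 * δ₁) (6 * δ₂) (by linarith) (by linarith) hB ?_)
    push_cast at hid; linarith
  · rintro rfl h2
    -- The coefficient `4 - 2m` vanishes, leaving `4 δ₂ ∫|τ|² = 0` and no information on `∫|dφ|²`.
    have hB0 : ∫ x, ‖SesquiHarmonic.tension N φ x‖ ^ 2 = 0 := by
      have h3 : δ₂ * ∫ x, ‖SesquiHarmonic.tension N φ x‖ ^ 2 = 0 := by
        push_cast at hid; linarith
      exact (mul_eq_zero.1 h3).resolve_left hδ₂
    have h4 := (MeasureTheory.integral_eq_zero_iff_of_nonneg (fun x => sq_nonneg _) htsq).1 hB0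
    filter_upwards [h4] with x hx
    simpa using hx
  · rintro rfl h1 h2
    refine hfinish three_pos (key (-2 * δ₁) (2 * δ₂) (by linarith) (by linarith) hB ?_)
    push_cast at hid; linarith
  · rintro rfl h1
    -- Here `8 - 2m = 0`, so the tension term drops out whatever the sign of `δ₂`.
    refine hfinish four_pos (key (-4 * δ₁) 0 (by linarith) le_rfl hB ?_)
    push_cast at hid; linarith
  · intro hm h1 h2
    have hm' : (5 : ℝ) ≤ m := by exact_mod_cast hm
    -- Both `4 - 2m` and `8 - 2m` are negative, so their products with the negative `δ₁`, `δ₂` are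
    -- positive.
    exact hfinish (by omega) (key _ _ (mul_pos_of_neg_of_neg h1 (by linarith))
      (mul_pos_of_neg_of_neg h2 (by linarith)).le hB hid)
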